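/- Let $P,N$ be real numbers with $0<N\le P$. For an integer $L\ge 2$ and distinct points $x_1,\dots,x_L\in\mathbb{R}^n$ with centroid $\bar x=\frac1L\sum_{i=1}^L x_i$, let $\overline{\mathrm{rad}}^2(x_1,\dots,x_L)=\frac1L\sum_{i=1}^L\|x_i-\bar x\|_2^2$. A set $\mathcal{C}\subseteq\mathbb{R}^n$ is called a $(P,N,L-1)$-average-radius multiple packing if all its points have Euclidean norm at most $\sqrt{nP}$ and $\inf_{\mathcal{L}}\overline{\mathrm{rad}}^2(\mathcal{L})>nN$, where $\mathcal{L}$ ranges over the $L$-element subsets of $\mathcal{C}$ (the infimum is $+\infty$ if there are none). Define $$\overline{C}_{L-1}(P,N)=\limsup_{n\to\infty}\ \sup_{\mathcal{C}}\ \frac1n\ln|\mathcal{C}|,$$ where the supremum is over all $(P,N,L-1)$-average-radius multiple packings $\mathcal{C}\subseteq\mathbb{R}^n$. Then the limit $\lim_{L\to\infty}\overline{C}_{L-1}(P,N)$ exists and equals $\frac12\ln\frac PN$. -/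

import Mathlib

open Filter Topology

noncomputable section

namespace MultiplePacking

/-- The centroid `(1/L) ∑ x` of a finite set of `L` points of `ℝⁿ`. -/
def centroid {n : ℕ} (s : Finset (EuclideanSpace ℝ (Fin n))) : EuclideanSpace ℝ (Fin n) :=
  (s.card : ℝ)⁻¹ • ∑ x ∈ s, x

/-- The average squared radius of a list `s` of `L` distinct points: the average squared distance
of the points of `s` to their centroid. -/
def avgSqRadius {n : ℕ} (s : Finset (EuclideanSpace ℝ (Fin n))) : ℝ :=
  (s.card : ℝ)⁻¹ * ∑ x ∈ s, ‖x - centroid s‖ ^ 2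

/-- The `(L-1)`-average squared radius of a code `C ⊆ ℝⁿ`: the infimum of the average squared
radius over all `L`-element subsets of `C` (it is `+∞` if `C` has no such subset). -/
def codeAvgSqRadius {n : ℕ} (L : ℕ) (C : Set (EuclideanSpace ℝ (Fin n))) : EReal :=
  ⨅ (s : Finset (EuclideanSpace ℝ (Fin n))) (_ : (s : Set (EuclideanSpace ℝ (Fin n))) ⊆ C)
    (_ : s.card = L), ((avgSqRadius s : ℝ) : EReal)

/-- `C ⊆ ℝⁿ` is a `(P, N, L-1)`-average-radius multiple packing: it lies in the closed ball of
radius `√(nP)` around the origin and its `(L-1)`-average squared radius exceeds `nN`. -/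
def IsAvgRadiusPacking {n : ℕ} (P N : ℝ) (L : ℕ) (C : Set (EuclideanSpace ℝ (Fin n))) : Prop :=
  C ⊆ Metric.closedBall 0 (Real.sqrt (n * P)) ∧ ((n * N : ℝ) : EReal) < codeAvgSqRadius L C

/-- The rate `(1/n) ln |C|` of a code, with `ln 0 = -∞` and `ln ∞ = +∞`. -/
def rate {n : ℕ} (C : Set (EuclideanSpace ℝ (Fin n))) : EReal :=
  ENNReal.log (C.encard : ENNReal) / (n : EReal)

/-- The `(P, N, L-1)`-average-radius multiple packing density (list-decoding capacity): the
`limsup` as `n → ∞` of the largest rate of a `(P, N, L-1)`-average-radius multiple packing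
in `ℝⁿ`. -/
def avgRadiusCapacity (P N : ℝ) (L : ℕ) : EReal :=
  limsup (fun n : ℕ => ⨆ (C : Set (EuclideanSpace ℝ (Fin n))) (_ : IsAvgRadiusPacking P N L C),
    rate C) atTop

end MultiplePacking

end

/-! Upper bound, valid for every `L`: the centroid minimises the mean squared distance, so a ball of
radius `√(nN)` holds fewer than `L` codewords. For a codeword `x`, the points `(1 - t) x + z` with
`z ⟂ x` and `‖z‖² ≤ nPt(1 - t)` lie within squared distance `nPt` of `x` and `nP(1 - t)` of the
origin. Thickening this slice along `x` costs a factor `δ` in volume and errors `2δ`. With `P(t +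
2δ) ≤ N`, no point lies in more than `L` of these sets, so comparing volumes bounds the code by
about `(L/δ) t^(-n/2)`, with `t` close to `N/P` (`IsAvgRadiusPacking.card_le`).

Lower bound, by random coding with expurgation in dimension `n = 2m`: draw about `exp(2γm)` uniform
points in the ball. If `L` of them have average squared radius at most `nN₁`, the product of their
Gaussian weights centred at `y` is at least 1 for all `y` near their centroid. Integrating over `y`
thus detects bad subsets, and for fixed `y` independence factors the mean. Up to a polynomial in
`m`, the bad subsets number at most `M (K q^L)^m`, where `K` is independent of `m` and `L`, and `q <
1` whenever `γ < ½ ln(P/N)` and `s` is close to `N`. A large `L` beats `K`, which is why the limit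
in `L` is needed (`exists_packing`). -/

noncomputable section
namespace MultiplePacking

open MeasureTheory Metric

/-! ### Centroids and the points of a packing in a small ball -/

section Centroid

variable {ι V : Type*} [NormedAddCommGroup V] [InnerProductSpace ℝ V]

/-- The parallel axis identity: for `c` the centroid of the `x i`, `i ∈ S`. -/
theorem sum_norm_sub_sq_of_card_smul_eq (S : Finset ι) (x : ι → V) (y c : V)
    (hc : (S.card : ℝ) • c = ∑ i ∈ S, x i) :
    ∑ i ∈ S, ‖x i - y‖ ^ 2 = ∑ i ∈ S, ‖x i - c‖ ^ 2 + S.card * ‖c - y‖ ^ 2 := by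
  have h1 : ∀ i, ‖x i - y‖ ^ 2 =
      ‖x i - c‖ ^ 2 + 2 * inner ℝ (x i - c) (c - y) + ‖c - y‖ ^ 2 := fun i => by
    rw [← norm_add_sq_real, sub_add_sub_cancel]
  have h2 : ∑ i ∈ S, inner ℝ (x i - c) (c - y) = 0 := by
    rw [← sum_inner, Finset.sum_sub_distrib, ← hc, Finset.sum_const, ← Nat.cast_smul_eq_nsmul ℝ,
      sub_self, inner_zero_left]
  simp only [h1, Finset.sum_add_distrib, ← Finset.mul_sum, h2, Finset.sum_const, nsmul_eq_mul]
  ring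

end Centroid

variable {n : ℕ}

theorem card_smul_centroid (s : Finset (EuclideanSpace ℝ (Fin n))) :
    (s.card : ℝ) • centroid s = ∑ x ∈ s, x := by
  rcases s.eq_empty_or_nonempty with rfl | hs
  · simp
  · have : (s.card : ℝ) ≠ 0 := by exact_mod_cast hs.card_pos.ne'
    rw [centroid, smul_inv_smul₀ this]

/-- By the parallel axis identity, moving the centre away from the centroid only increases the mean
squared distance. The sign of `r` matters only for empty `s`. -/
theorem avgSqRadius_le_of_norm_sub_sq_le (s : Finset (EuclideanSpace ℝ (Fin n))) {r : ℝ}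
    (hr : 0 ≤ r) (y : EuclideanSpace ℝ (Fin n)) (h : ∀ x ∈ s, ‖x - y‖ ^ 2 ≤ r) :
    avgSqRadius s ≤ r := by
  have h1 := sum_norm_sub_sq_of_card_smul_eq s id y _ (card_smul_centroid s)
  have h2 : ∑ x ∈ s, ‖x - y‖ ^ 2 ≤ s.card * r := by
    simpa using Finset.sum_le_card_nsmul s _ _ h
  have h3 : 0 ≤ s.card * ‖centroid s - y‖ ^ 2 := by positivity
  simp only [id] at h1
  rw [avgSqRadius, inv_mul_eq_div]
  exact div_le_of_le_mul₀ (by positivity) hr (by linarith)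

/-- Balls of radius `√(nN)` contain fewer than `L` points of a packing. -/
theorem IsAvgRadiusPacking.card_filter_lt {P N : ℝ} {L : ℕ}
    {C : Set (EuclideanSpace ℝ (Fin n))} (hC : IsAvgRadiusPacking P N L C) (hN : 0 ≤ N)
    {F : Finset (EuclideanSpace ℝ (Fin n))} (hF : (F : Set (EuclideanSpace ℝ (Fin n))) ⊆ C)
    (y : EuclideanSpace ℝ (Fin n)) :
    (F.filter fun x => ‖x - y‖ ^ 2 ≤ n * N).card < L := by
  by_contra! h
  obtain ⟨s, hs, hcard⟩ := Finset.exists_subset_card_eq h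
  have h1 : avgSqRadius s ≤ n * N := avgSqRadius_le_of_norm_sub_sq_le s (by positivity) y
    fun x hx => (Finset.mem_filter.1 (hs hx)).2
  have h2 : codeAvgSqRadius L C ≤ ((avgSqRadius s : ℝ) : EReal) :=
    iInf_le_of_le s <| iInf_le_of_le
      (fun x hx => hF (Finset.mem_filter.1 (hs hx)).1) <| iInf_le_of_le hcard le_rfl
  exact absurd (hC.2.trans_le (h2.trans (EReal.coe_le_coe_iff.2 h1))) (lt_irrefl _)

/-! ### Flattened balls and the volume upper bound -/

section Contraction

variable {V : Type*} [NormedAddCommGroup V] [InnerProductSpace ℝ V]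

/-- The contraction by the factor `δ` in the direction of `x`. -/
def contractAlong (δ : ℝ) (x : V) : V →ₗ[ℝ] V :=
  LinearMap.transvection (innerₛₗ ℝ x) (((δ - 1) / ‖x‖ ^ 2) • x)

theorem contractAlong_apply (δ : ℝ) (x z : V) :
    contractAlong δ x z = z + ((δ - 1) / ‖x‖ ^ 2 * inner ℝ x z) • x := by
  simp [contractAlong, LinearMap.transvection.apply, smul_smul, mul_comm]

theorem inner_contractAlong (δ : ℝ) (x z : V) :
    inner ℝ x (contractAlong δ x z) = δ * inner ℝ x z := by
  rcases eq_or_ne x 0 with rfl | hx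
  · simp
  · have : ‖x‖ ≠ 0 := norm_ne_zero_iff.2 hx
    rw [contractAlong_apply, inner_add_right, inner_smul_right, real_inner_self_eq_norm_sq]
    field_simp
    ring

theorem norm_contractAlong_le {δ : ℝ} (h0 : 0 ≤ δ) (h1 : δ ≤ 1) (x z : V) :
    ‖contractAlong δ x z‖ ≤ ‖z‖ := by
  rcases eq_or_ne x 0 with rfl | hx
  · simp [contractAlong_apply]
  · have h : ‖x‖ ≠ 0 := norm_ne_zero_iff.2 hx
    refine le_of_sq_le_sq ?_ (norm_nonneg _)
    have h2 : ‖contractAlong δ x z‖ ^ 2 = ‖z‖ ^ 2 - (1 - δ ^ 2) * (inner ℝ x z / ‖x‖) ^ 2 := by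
      rw [contractAlong_apply, norm_add_sq_real, inner_smul_right, norm_smul, mul_pow,
        Real.norm_eq_abs, sq_abs, real_inner_comm]
      field_simp
      ring
    have h3 : 0 ≤ (1 - δ ^ 2) * (inner ℝ x z / ‖x‖) ^ 2 :=
      mul_nonneg (by nlinarith) (sq_nonneg _)
    linarith

/-- The determinant is `δ` for `x ≠ 0`, but the map is the identity for `x = 0`; hence an
inequality. -/
theorem le_det_contractAlong [FiniteDimensional ℝ V] {δ : ℝ} (h1 : δ ≤ 1) (x : V) :
    δ ≤ LinearMap.det (contractAlong δ x) := by
  rw [contractAlong, LinearMap.transvection.det]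
  rcases eq_or_ne x 0 with rfl | hx
  · simpa using h1
  · have h : ‖x‖ ≠ 0 := norm_ne_zero_iff.2 hx
    simp only [innerₛₗ_apply_apply, inner_smul_right, real_inner_self_eq_norm_sq]
    field_simp
    linarith

/-- Points `(1 - t) x + z`, with `z` in a flattened ball orthogonal to `x`, are simultaneously
close to `x` and to the origin. -/
theorem norm_sq_add_contractAlong_le {δ t r : ℝ} (h0 : 0 ≤ δ) (h1 : δ ≤ 1) (ht0 : 0 ≤ t)
    (ht1 : t ≤ 1) {x z : V} (hx : ‖x‖ ^ 2 ≤ r) (hz : ‖z‖ ^ 2 ≤ r * (t * (1 - t))) :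
    ‖(1 - t) • x + contractAlong δ x z‖ ^ 2 ≤ r * (1 - t + 2 * δ) ∧
      ‖x - ((1 - t) • x + contractAlong δ x z)‖ ^ 2 ≤ r * (t + 2 * δ) := by
  have hr : 0 ≤ r := (sq_nonneg _).trans hx
  have hT : ‖contractAlong δ x z‖ ^ 2 ≤ r * (t * (1 - t)) :=
    (pow_le_pow_left₀ (norm_nonneg _) (norm_contractAlong_le h0 h1 x z) 2).trans hz
  have hin : |inner ℝ x (contractAlong δ x z)| ≤ δ * r := by
    rw [inner_contractAlong, abs_mul, abs_of_nonneg h0]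
    refine mul_le_mul_of_nonneg_left ((abs_real_inner_le_norm x z).trans ?_) h0
    have : ‖z‖ ^ 2 ≤ r := hz.trans (mul_le_of_le_one_right hr (by nlinarith))
    nlinarith [sq_nonneg (‖x‖ - ‖z‖)]
  rw [abs_le] at hin
  have e : x - ((1 - t) • x + contractAlong δ x z) = t • x - contractAlong δ x z := by
    rw [sub_smul, one_smul]; abel
  rw [e, norm_add_sq_real, norm_sub_sq_real, norm_smul, norm_smul, mul_pow, mul_pow,
    inner_smul_left, inner_smul_left, Real.norm_eq_abs, Real.norm_eq_abs, sq_abs, sq_abs]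
  simp only [conj_trivial]
  have hδr : 0 ≤ δ * r := mul_nonneg h0 hr
  constructor
  · have a1 : (1 - t) ^ 2 * ‖x‖ ^ 2 ≤ (1 - t) ^ 2 * r := by gcongr
    have a2 : (1 - t) * inner ℝ x (contractAlong δ x z) ≤ δ * r := by
      nlinarith
    nlinarith
  · have a1 : t ^ 2 * ‖x‖ ^ 2 ≤ t ^ 2 * r := by gcongr
    have a2 : -(δ * r) ≤ t * inner ℝ x (contractAlong δ x z) := by
      nlinarith
    nlinarith

end Contraction

theorem ofReal_mul_volume_le_volume_image {V : Type*} [NormedAddCommGroup V]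
    [InnerProductSpace ℝ V] [FiniteDimensional ℝ V] [MeasurableSpace V] [BorelSpace V]
    {δ : ℝ} (h1 : δ ≤ 1) (x u : V) (A : Set V) :
    ENNReal.ofReal δ * volume A ≤ volume ((fun z => u + contractAlong δ x z) '' A) := by
  have : (fun z => u + contractAlong δ x z) '' A = (fun z => u + z) '' (contractAlong δ x '' A) :=
    (Set.image_image _ _ _).symm
  rw [this, Set.image_add_left, measure_preimage_add, Measure.addHaar_image_linearMap]
  gcongr
  exact (le_det_contractAlong h1 x).trans (le_abs_self _)

/-- Double counting: sets of measure at least `a` inside `B`, no point being in more than `K` of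
them, number at most `K * μ B / a`. -/
theorem card_mul_le_of_card_filter_le {α ι : Type*} [MeasurableSpace α] {μ : Measure α}
    (F : Finset ι) (A : ι → Set α) (B : Set α) (a : ENNReal) (K : ℕ)
    (hA : ∀ i ∈ F, MeasurableSet (A i)) (hAB : ∀ i ∈ F, A i ⊆ B) (ha : ∀ i ∈ F, a ≤ μ (A i))
    (hK : ∀ y ∈ B, ∀ G ⊆ F, (∀ i ∈ G, y ∈ A i) → G.card ≤ K) :
    F.card * a ≤ K * μ B := by
  classical
  calc (F.card : ENNReal) * a ≤ ∑ i ∈ F, μ (A i) := by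
        simpa using Finset.card_nsmul_le_sum F _ _ ha
    _ = ∑ i ∈ F, ∫⁻ y, (A i).indicator 1 y ∂μ.restrict B := by
        refine Finset.sum_congr rfl fun i hi => ?_
        rw [lintegral_indicator_one (hA i hi), Measure.restrict_apply (hA i hi),
          Set.inter_eq_left.2 (hAB i hi)]
    _ = ∫⁻ y, ∑ i ∈ F, (A i).indicator 1 y ∂μ.restrict B := by
        rw [lintegral_finsetSum _ fun i hi => measurable_one.indicator (hA i hi)]
    _ ≤ ∫⁻ _ in B, K ∂μ := by
        have hs : ∀ y, ∑ i ∈ F, (A i).indicator (1 : α → ENNReal) y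
            = (F.filter fun i => y ∈ A i).card := fun y => by
          simp [Set.indicator_apply]
        refine lintegral_mono fun y => ?_
        by_cases hy : y ∈ B
        · rw [hs]
          exact Nat.cast_le.2 (hK y hy _ (Finset.filter_subset _ _) fun i hi =>
            (Finset.mem_filter.1 hi).2)
        · rw [hs, Finset.filter_false_of_mem fun i hi h => hy (hAB i hi h)]
          simp
    _ = K * μ B := by simp

/-- A finite part of a packing has at most `(L/δ) ((1 - t + 2 δ) / (t (1 - t)))^{n/2}` points. -/
theorem IsAvgRadiusPacking.card_le {P N : ℝ} {L : ℕ}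
    {C : Set (EuclideanSpace ℝ (Fin n))} (hC : IsAvgRadiusPacking P N L C) (hN : 0 ≤ N)
    (hn : n ≠ 0) (hP : 0 < P) {δ t : ℝ} (h0 : 0 < δ) (h1 : δ ≤ 1) (ht0 : 0 < t) (ht1 : t < 1)
    (htN : P * (t + 2 * δ) ≤ N)
    {F : Finset (EuclideanSpace ℝ (Fin n))} (hF : (F : Set (EuclideanSpace ℝ (Fin n))) ⊆ C) :
    (F.card : ℝ) ≤ L / δ * √((1 - t + 2 * δ) / (t * (1 - t))) ^ n := by
  have ht1' : 0 < 1 - t := sub_pos.2 ht1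
  have hn' : (0 : ℝ) < n := by positivity
  set ρ := √(n * P * (t * (1 - t))) with hρ
  set R := √(n * P * (1 - t + 2 * δ)) with hR
  have hρ0 : 0 < ρ := Real.sqrt_pos.2 (by positivity)
  have key : ∀ x ∈ F, ∀ z ∈ closedBall (0 : EuclideanSpace ℝ (Fin n)) ρ,
      ‖(1 - t) • x + contractAlong δ x z‖ ^ 2 ≤ n * P * (1 - t + 2 * δ) ∧
      ‖x - ((1 - t) • x + contractAlong δ x z)‖ ^ 2 ≤ n * P * (t + 2 * δ) := by
    intro x hx z hz
    refine norm_sq_add_contractAlong_le h0.le h1 ht0.le ht1.le ?_ ?_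
    · have := hC.1 (hF hx)
      rw [mem_closedBall_zero_iff] at this
      exact (Real.le_sqrt (norm_nonneg _) (by positivity)).1 this
    · rw [mem_closedBall_zero_iff] at hz
      exact (Real.le_sqrt (norm_nonneg _) (by positivity)).1 hz
  have hmain := card_mul_le_of_card_filter_le (μ := volume) F
    (fun x => (fun z => (1 - t) • x + contractAlong δ x z) '' closedBall 0 ρ) (closedBall 0 R)
    (ENNReal.ofReal δ * volume (closedBall (0 : EuclideanSpace ℝ (Fin n)) ρ)) L
    (fun x _ => by
      refine ((isCompact_closedBall _ _).image ?_).isClosed.measurableSet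
      exact continuous_const.add (contractAlong δ x).continuous_of_finiteDimensional)
    (by
      rintro x hx _ ⟨z, hz, rfl⟩
      rw [mem_closedBall_zero_iff]
      exact Real.le_sqrt_of_sq_le (key x hx z hz).1)
    (fun x _ => ofReal_mul_volume_le_volume_image h1 _ _ _)
    (by
      intro y _ G hG hGy
      refine (Finset.card_le_card fun x hx => ?_).trans (hC.card_filter_lt hN hF y).le
      obtain ⟨z, hz, rfl⟩ := hGy x hx
      refine Finset.mem_filter.2 ⟨hG hx, (key x (hG hx) z hz).2.trans ?_⟩
      rw [mul_assoc]
      gcongr)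
  rw [Measure.addHaar_closedBall _ _ hρ0.le, Measure.addHaar_closedBall _ _ (Real.sqrt_nonneg _),
    ← mul_assoc, ← mul_assoc, ← mul_assoc, ENNReal.mul_le_mul_iff_left
      (measure_ball_pos _ _ one_pos).ne' measure_ball_lt_top.ne, finrank_euclideanSpace_fin,
    ← ENNReal.ofReal_natCast, ← ENNReal.ofReal_natCast, ← ENNReal.ofReal_mul (by positivity),
    ← ENNReal.ofReal_mul (by positivity), ← ENNReal.ofReal_mul (by positivity),
    ENNReal.ofReal_le_ofReal_iff (by positivity)] at hmain
  have hq : √((1 - t + 2 * δ) / (t * (1 - t))) = R / ρ := by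
    rw [hR, hρ, ← Real.sqrt_div' _ (by positivity), mul_div_mul_left _ _ (by positivity)]
  rw [hq, div_pow, div_mul_div_comm, le_div_iff₀ (by positivity)]
  linarith

/-! ### Random coding: first moment and expurgation -/

/-- A weak Stirling bound: the induction step is `e ≤ (1 + 1/m)^(m+1)`. The loss `e m` is polynomial
and does not affect rates. -/
theorem factorial_le_exp_one_mul (m : ℕ) (hm : 1 ≤ m) :
    (m.factorial : ℝ) * Real.exp 1 ^ m ≤ Real.exp 1 * m * (m : ℝ) ^ m := by
  induction m, hm using Nat.le_induction with
  | base => simp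
  | succ m hm ih =>
    have hm0 : (0 : ℝ) < m := by exact_mod_cast hm
    have key : Real.exp 1 * (m : ℝ) ^ (m + 1) ≤ (m + 1 : ℝ) ^ (m + 1) := by
      have h1 : Real.exp ((m + 1 : ℝ)⁻¹) ≤ (m + 1) / m := by
        rw [← Real.le_log_iff_exp_le (by positivity)]
        have := Real.one_sub_inv_le_log_of_pos (x := (m + 1 : ℝ) / m) (by positivity)
        refine le_trans (le_of_eq ?_) this
        field_simp
        ring
      have h2 := pow_le_pow_left₀ (Real.exp_pos _).le h1 (m + 1)
      rw [← Real.exp_nat_mul, div_pow, le_div_iff₀ (by positivity)] at h2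
      have h3 : ((m + 1 : ℕ) : ℝ) * (m + 1 : ℝ)⁻¹ = 1 := by
        push_cast
        field_simp
      rwa [h3] at h2
    calc ((m + 1).factorial : ℝ) * Real.exp 1 ^ (m + 1)
        = (m + 1) * Real.exp 1 * (m.factorial * Real.exp 1 ^ m) := by
          rw [Nat.factorial_succ]; push_cast; ring
      _ ≤ (m + 1) * Real.exp 1 * (Real.exp 1 * m * (m : ℝ) ^ m) := by gcongr
      _ = Real.exp 1 * (m + 1) * (Real.exp 1 * (m : ℝ) ^ (m + 1)) := by ring
      _ ≤ Real.exp 1 * (m + 1) * (m + 1 : ℝ) ^ (m + 1) := by gcongr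
      _ = _ := by push_cast; ring

section Averaging

variable {V : Type*} [NormedAddCommGroup V] [MeasurableSpace V] [BorelSpace V]
  [SecondCountableTopology V]

/-- The first moment method: there are points in `B` for which the sum over all `L`-subsets of the
weights `∫_D ∏ g (x i - y) dν(y)` is at most its mean. -/
theorem exists_sum_lintegral_prod_le (μ ν : Measure V) [IsProbabilityMeasure μ] [SFinite ν]
    {B D : Set V} (hB : ∀ᵐ x ∂μ, x ∈ B) {g : V → ENNReal} (hg : Measurable g)
    {I : ENNReal} (hI : ∀ y, ∫⁻ x, g (x - y) ∂μ ≤ I) (M L : ℕ) :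
    ∃ x : Fin M → V, (∀ i, x i ∈ B) ∧
      ∑ S ∈ Finset.powersetCard L Finset.univ, ∫⁻ y in D, ∏ i ∈ S, g (x i - y) ∂ν
        ≤ M.choose L * (ν D * I ^ L) := by
  have hmeas : ∀ S : Finset (Fin M),
      Measurable (fun p : (Fin M → V) × V => ∏ i ∈ S, g (p.1 i - p.2)) := fun S => by
    refine Finset.measurable_fun_prod _ fun i _ => hg.comp ?_
    fun_prop
  have hint : ∫⁻ x, ∑ S ∈ Finset.powersetCard L Finset.univ,
      ∫⁻ y in D, ∏ i ∈ S, g (x i - y) ∂ν ∂(Measure.pi fun _ : Fin M => μ)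
        ≤ M.choose L * (ν D * I ^ L) := by
    rw [lintegral_finsetSum _ fun S _ => (hmeas S).lintegral_prod_right']
    have : ∀ S ∈ Finset.powersetCard L (Finset.univ : Finset (Fin M)),
        ∫⁻ x, ∫⁻ y in D, ∏ i ∈ S, g (x i - y) ∂ν ∂(Measure.pi fun _ : Fin M => μ)
          ≤ ν D * I ^ L := by
      intro S hS
      -- Once `y` is fixed, the factors are independent and each has mean at most `I`.
      rw [lintegral_lintegral_swap (hmeas S).aemeasurable]
      calc _ ≤ ∫⁻ _ in D, I ^ L ∂ν := by
            refine lintegral_mono fun y => ?_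
            have hgy : Measurable fun x => g (x - y) := hg.comp (measurable_id.sub_const y)
            rw [ProbabilityTheory.lintegral_prod_eq_prod_lintegral_of_indepFun S
              (fun i (x : Fin M → V) => g (x i - y))
              (ProbabilityTheory.iIndepFun_pi (X := fun _ x => g (x - y))
                fun _ => hgy.aemeasurable)
              (fun i => hgy.comp (measurable_pi_apply i)),
              ← (Finset.mem_powersetCard.1 hS).2]
            refine Finset.prod_le_pow_card _ _ _ fun i _ => ?_
            refine le_trans (le_of_eq ?_) (hI y)
            exact (measurePreserving_eval (fun _ : Fin M => μ) i).lintegral_comp hgy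
        _ = _ := by rw [setLIntegral_const, mul_comm]
    refine (Finset.sum_le_card_nsmul _ _ _ this).trans ?_
    simp
  have hN : ∀ᵐ x ∂(Measure.pi fun _ : Fin M => μ), ∀ i, x i ∈ B :=
    ae_all_iff.2 fun i => Measure.tendsto_eval_ae_ae hB
  obtain ⟨x, hx, hx'⟩ := exists_notMem_null_le_lintegral
    (Finset.measurable_fun_sum _ fun S _ =>
      (hmeas S).lintegral_prod_right' (ν := ν.restrict D)).aemeasurable
    (ae_iff.1 hN)
  exact ⟨x, not_not.1 hx, hx'.trans hint⟩

end Averaging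

/-- A finite family of nonempty sets is avoided by a set missing at most one point for each
member of the family. -/
theorem exists_card_le_add_of_nonempty {ι : Type*} [Fintype ι] [DecidableEq ι]
    (A : Finset (Finset ι)) (hA : ∀ S ∈ A, S.Nonempty) :
    ∃ T : Finset ι, Fintype.card ι ≤ T.card + A.card ∧ ∀ S ∈ A, ¬ S ⊆ T := by
  rcases isEmpty_or_nonempty ι with hι | hι
  · exact ⟨Finset.univ, by simp, fun S hS => ((hA S hS).elim fun i _ => hι.elim i)⟩
  choose! f hf using hA
  refine ⟨(A.image f)ᶜ, ?_, fun S hS h => ?_⟩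
  · have := Finset.card_compl_add_card (A.image f)
    have := Finset.card_image_le (s := A) (f := f)
    omega
  · exact Finset.mem_compl.1 (h (hf S hS)) (Finset.mem_image_of_mem f hS)

/-- The average squared radius of an indexed family, with repetitions allowed. -/
def famSqRadius {ι : Type*} (S : Finset ι) (x : ι → EuclideanSpace ℝ (Fin n)) : ℝ :=
  (S.card : ℝ)⁻¹ * ∑ i ∈ S, ‖x i - (S.card : ℝ)⁻¹ • ∑ j ∈ S, x j‖ ^ 2

theorem avgSqRadius_image {ι : Type*} [DecidableEq (EuclideanSpace ℝ (Fin n))] (S : Finset ι)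
    (x : ι → EuclideanSpace ℝ (Fin n)) (h : Set.InjOn x S) :
    avgSqRadius (S.image x) = famSqRadius S x := by
  rw [avgSqRadius, famSqRadius, centroid, Finset.card_image_of_injOn h, Finset.sum_image h,
    Finset.sum_image h]

theorem famSqRadius_eq_zero {ι : Type*} (S : Finset ι) (x : ι → EuclideanSpace ℝ (Fin n))
    (a : EuclideanSpace ℝ (Fin n)) (h : ∀ i ∈ S, x i = a) : famSqRadius S x = 0 := by
  have : ∀ i ∈ S, ‖x i - (S.card : ℝ)⁻¹ • ∑ j ∈ S, x j‖ ^ 2 = 0 := fun i hi => by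
    have hS : (S.card : ℝ) ≠ 0 := by exact_mod_cast (Finset.card_pos.2 ⟨i, hi⟩).ne'
    rw [Finset.sum_congr rfl h, Finset.sum_const, ← Nat.cast_smul_eq_nsmul ℝ, inv_smul_smul₀ hS,
      h i hi]
    simp
  rw [famSqRadius, Finset.sum_congr rfl this]
  simp

/-- Expurgation: deleting one index from each bad `L`-subset leaves a packing. -/
theorem exists_packing_of_card_bad_le {P N N₁ : ℝ} (hN : 0 ≤ N₁) (hNN : N < N₁) (hn : n ≠ 0)
    {L M : ℕ} (hL : 1 ≤ L) (x : Fin M → EuclideanSpace ℝ (Fin n))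
    (hx : ∀ i, x i ∈ closedBall (0 : EuclideanSpace ℝ (Fin n)) (Real.sqrt (n * P)))
    (hbad : 2 * ((Finset.powersetCard L Finset.univ).filter
      fun S => famSqRadius S x ≤ n * N₁).card ≤ M) :
    ∃ C : Finset (EuclideanSpace ℝ (Fin n)),
      IsAvgRadiusPacking P N L (C : Set (EuclideanSpace ℝ (Fin n))) ∧ M ≤ 2 * (L * C.card) := by
  classical
  obtain ⟨T, hT, hTA⟩ := exists_card_le_add_of_nonempty
    ((Finset.powersetCard L (Finset.univ : Finset (Fin M))).filter
      fun S => famSqRadius S x ≤ n * N₁) (fun S hS => Finset.card_pos.1 (by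
        have := (Finset.mem_powersetCard.1 (Finset.mem_filter.1 hS).1).2
        omega))
  have hgood : ∀ S ⊆ T, S.card = L → n * N₁ < famSqRadius S x := fun S hST hS => by
    by_contra! h
    exact hTA S (Finset.mem_filter.2
      ⟨Finset.mem_powersetCard.2 ⟨Finset.subset_univ _, hS⟩, h⟩) hST
  refine ⟨T.image x, ⟨?_, ?_⟩, ?_⟩
  · intro a ha
    obtain ⟨i, -, rfl⟩ := Finset.mem_image.1 (Finset.mem_coe.1 ha)
    exact hx i
  -- The infimum is bounded below by `n * N₁` only weakly; the gap `N < N₁` restores strictness.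
  · have hlt : n * N < n * N₁ := by
      have : (0 : ℝ) < n := by positivity
      gcongr
    refine (EReal.coe_lt_coe_iff.2 hlt).trans_le ?_
    refine le_iInf fun s => le_iInf fun hs => le_iInf fun hcard => ?_
    obtain ⟨S, hST, hinj, rfl⟩ := Finset.exists_subset_injOn_image_eq_of_surjOn (f := x)
      (T : Set (Fin M)) s (fun a ha => by simpa using hs ha)
    rw [avgSqRadius_image S x hinj]
    rw [Finset.card_image_of_injOn hinj] at hcard
    exact EReal.coe_le_coe_iff.2 (hgood S (by exact_mod_cast hST) hcard).le
  -- `L` coinciding points would have radius zero and be bad, so no value is repeated more than `L`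
  -- times.
  · have h1 : T.card ≤ L * (T.image x).card := by
      refine Finset.card_le_mul_card_image _ _ fun a _ => ?_
      by_contra! h
      obtain ⟨S, hS, hcard⟩ := Finset.exists_subset_card_eq h.le
      have h2 := hgood S (hS.trans (Finset.filter_subset _ _)) hcard
      rw [famSqRadius_eq_zero S x a fun i hi => (Finset.mem_filter.1 (hS hi)).2] at h2
      exact absurd h2 (not_lt.2 (by positivity))
    rw [Fintype.card_fin] at hT
    omega

/-! ### Gaussian weights and existence of packings -/

/-- The weight `exp ((n s - ‖z‖²) / (2 s))`, which dominates the indicator of the ball of radius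
`√(n s)`. -/
def gaussWeight (n : ℕ) (s : ℝ) (z : EuclideanSpace ℝ (Fin n)) : ENNReal :=
  ENNReal.ofReal (Real.exp ((n * s - ‖z‖ ^ 2) / (2 * s)))

theorem measurable_gaussWeight (n : ℕ) (s : ℝ) : Measurable (gaussWeight n s) := by
  unfold gaussWeight
  fun_prop

theorem lintegral_gaussWeight {m : ℕ} {s : ℝ} (hs : 0 < s) :
    ∫⁻ z, gaussWeight (2 * m) s z
      = ENNReal.ofReal ((Real.exp 1 * (2 * Real.pi * s)) ^ m) := by
  have hb : 0 < (2 * s)⁻¹ := by positivity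
  have h1 := GaussianFourier.integral_rexp_neg_mul_sq_norm (V := EuclideanSpace ℝ (Fin (2 * m))) hb
  -- A non-integrable function has integral zero by convention, so the nonzero value `h1` gives
  -- integrability.
  have h2 : Integrable fun z : EuclideanSpace ℝ (Fin (2 * m)) =>
      Real.exp (-(2 * s)⁻¹ * ‖z‖ ^ 2) :=
    not_imp_comm.1 integral_undef (by rw [h1]; positivity)
  have h3 : ∀ z : EuclideanSpace ℝ (Fin (2 * m)), gaussWeight (2 * m) s z =
      ENNReal.ofReal (Real.exp 1 ^ m) * ENNReal.ofReal (Real.exp (-(2 * s)⁻¹ * ‖z‖ ^ 2)) := by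
    intro z
    rw [gaussWeight, ← ENNReal.ofReal_mul (by positivity), ← Real.exp_nat_mul, ← Real.exp_add]
    congr 2
    push_cast
    field_simp
    ring
  simp_rw [h3]
  rw [lintegral_const_mul _ (by fun_prop), ← ofReal_integral_eq_lintegral_ofReal h2
    (Eventually.of_forall fun _ => (Real.exp_pos _).le), h1, ← ENNReal.ofReal_mul (by positivity),
    finrank_euclideanSpace_fin, mul_pow]
  congr 2
  have : ((2 * m : ℕ) : ℝ) / 2 = m := by push_cast; ring
  rw [this, Real.rpow_natCast]
  congr 1
  field_simp

/-- Even dimension turns the Gamma function into a factorial; a `limsup` lower bound needs only this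
subsequence. -/
theorem volume_closedBall_sqrt {m : ℕ} (hm : 1 ≤ m) {P : ℝ} (hP : 0 ≤ P) :
    volume (closedBall (0 : EuclideanSpace ℝ (Fin (2 * m))) √((2 * m : ℕ) * P))
      = ENNReal.ofReal ((2 * m * P * Real.pi) ^ m / m.factorial) := by
  have : Nonempty (Fin (2 * m)) := ⟨⟨0, by omega⟩⟩
  rw [InnerProductSpace.volume_closedBall_of_dim_even (k := m) (by simp),
    finrank_euclideanSpace_fin, ← ENNReal.ofReal_pow (by positivity),
    ← ENNReal.ofReal_mul (by positivity), pow_mul, Real.sq_sqrt (by positivity), mul_pow _ Real.pi]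
  congr 1
  push_cast
  ring

/-- The mean over the ball of radius `√(nP)`, `n = 2 m`, of a translated weight. -/
theorem lintegral_gaussWeight_cond_le {m : ℕ} (hm : 1 ≤ m) {P s : ℝ} (hP : 0 < P) (hs : 0 < s)
    (y : EuclideanSpace ℝ (Fin (2 * m))) :
    ∫⁻ x, gaussWeight (2 * m) s (x - y) ∂(ProbabilityTheory.cond volume
        (closedBall (0 : EuclideanSpace ℝ (Fin (2 * m))) √((2 * m : ℕ) * P)))
      ≤ ENNReal.ofReal (Real.exp 1 * m * (s / P) ^ m) := by
  have hm0 : (0 : ℝ) < m := by exact_mod_cast hm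
  rw [ProbabilityTheory.cond, lintegral_smul_measure, volume_closedBall_sqrt hm hP.le]
  have h1 : ∫⁻ x in closedBall (0 : EuclideanSpace ℝ (Fin (2 * m))) √((2 * m : ℕ) * P),
      gaussWeight (2 * m) s (x - y) ≤ ENNReal.ofReal ((Real.exp 1 * (2 * Real.pi * s)) ^ m) := by
    rw [← lintegral_gaussWeight hs, ← lintegral_sub_right_eq_self (gaussWeight (2 * m) s) y]
    exact setLIntegral_le_lintegral _ _
  refine (mul_le_mul_right h1 _).trans ?_
  rw [← ENNReal.ofReal_inv_of_pos (by positivity), ← ENNReal.ofReal_mul (by positivity)]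
  refine ENNReal.ofReal_le_ofReal ?_
  have h2 := factorial_le_exp_one_mul m hm
  rw [inv_div, div_mul_eq_mul_div, div_le_iff₀ (by positivity), div_pow]
  calc (m.factorial : ℝ) * (Real.exp 1 * (2 * Real.pi * s)) ^ m
      = (m.factorial * Real.exp 1 ^ m) * (2 * Real.pi * s) ^ m := by rw [mul_pow]; ring
    _ ≤ (Real.exp 1 * m * (m : ℝ) ^ m) * (2 * Real.pi * s) ^ m := by gcongr
    _ = _ := by
      field_simp
      ring

/-- A bad family contributes at least the volume of a ball to the averaged weight. -/
theorem volume_closedBall_le_of_famSqRadius_le {ι : Type*} {N₁ ε R : ℝ} (hN : 0 ≤ N₁) (hε : 0 < ε)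
    (S : Finset ι) (hS : S.Nonempty) (x : ι → EuclideanSpace ℝ (Fin n))
    (hx : ∀ i, x i ∈ closedBall (0 : EuclideanSpace ℝ (Fin n)) R)
    (h : famSqRadius S x ≤ n * N₁) :
    volume (closedBall (0 : EuclideanSpace ℝ (Fin n)) √(n * ε)) ≤
      ∫⁻ y in closedBall 0 (R + √(n * ε)), ∏ i ∈ S, gaussWeight n (N₁ + ε) (x i - y) := by
  have hS0 : (0 : ℝ) < S.card := by exact_mod_cast hS.card_pos
  set c := (S.card : ℝ)⁻¹ • ∑ j ∈ S, x j with hc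
  have hc' : (S.card : ℝ) • c = ∑ j ∈ S, x j := smul_inv_smul₀ hS0.ne' _
  have hcR : ‖c‖ ≤ R := by
    rw [hc, norm_smul, norm_inv, Real.norm_natCast, inv_mul_le_iff₀ hS0]
    refine (norm_sum_le _ _).trans ?_
    simpa using Finset.sum_le_card_nsmul S _ _ fun i _ => mem_closedBall_zero_iff.1 (hx i)
  have hsub : closedBall c √(n * ε) ⊆ closedBall 0 (R + √(n * ε)) := by
    refine closedBall_subset_closedBall' ?_
    rw [dist_zero_right]
    linarith
  -- The parallel axis identity bounds the total squared distance to `y` by `|S| n (N₁ + ε)`, so the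
  -- summed exponent is nonnegative.
  have hone : ∀ y ∈ closedBall c √(n * ε), 1 ≤ ∏ i ∈ S, gaussWeight n (N₁ + ε) (x i - y) := by
    intro y hy
    rw [mem_closedBall, dist_comm, dist_eq_norm, Real.le_sqrt (norm_nonneg _) (by positivity)] at hy
    simp only [gaussWeight]
    rw [← ENNReal.ofReal_prod_of_nonneg fun _ _ => (Real.exp_pos _).le, ← Real.exp_sum,
      ENNReal.one_le_ofReal, Real.one_le_exp_iff, ← Finset.sum_div, Finset.sum_sub_distrib,
      sum_norm_sub_sq_of_card_smul_eq S x y c hc', Finset.sum_const, nsmul_eq_mul]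
    rw [famSqRadius, inv_mul_le_iff₀ hS0] at h
    refine div_nonneg ?_ (by positivity)
    have : S.card * ‖c - y‖ ^ 2 ≤ S.card * (n * ε) := by gcongr
    linarith
  calc volume (closedBall (0 : EuclideanSpace ℝ (Fin n)) √(n * ε))
      = volume (closedBall c √(n * ε)) := (Measure.addHaar_closedBall_center _ _ _).symm
    _ = ∫⁻ y in closedBall c √(n * ε), 1 := by simp
    _ ≤ ∫⁻ y in closedBall c √(n * ε), ∏ i ∈ S, gaussWeight n (N₁ + ε) (x i - y) :=
        setLIntegral_mono' isClosed_closedBall.measurableSet hone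
    _ ≤ _ := lintegral_mono_set hsub

/-- The random coding bound with expurgation, in even dimension. -/
theorem exists_packing {P N N₁ ε : ℝ} (hP : 0 < P) (hN : 0 ≤ N₁) (hNN : N < N₁) (hε : 0 < ε)
    {m L M : ℕ} (hm : 1 ≤ m) (hL : 1 ≤ L)
    (hM : 2 * ((M : ℝ) ^ L * ((((√P + √ε) / √ε) ^ 2) ^ m *
      (Real.exp 1 * m * ((N₁ + ε) / P) ^ m) ^ L)) ≤ M) :
    ∃ C : Finset (EuclideanSpace ℝ (Fin (2 * m))),
      IsAvgRadiusPacking P N L (C : Set (EuclideanSpace ℝ (Fin (2 * m)))) ∧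
        M ≤ 2 * (L * C.card) := by
  have hm0 : (0 : ℝ) < m := by exact_mod_cast hm
  set B := closedBall (0 : EuclideanSpace ℝ (Fin (2 * m))) √((2 * m : ℕ) * P) with hB
  set r := √((2 * m : ℕ) * ε) with hr
  have hr0 : 0 < r := Real.sqrt_pos.2 (by positivity)
  have hB0 : volume B ≠ 0 := by
    rw [hB, volume_closedBall_sqrt hm hP.le]
    simp only [ne_eq, ENNReal.ofReal_eq_zero, not_le]
    positivity
  have hBtop : volume B ≠ ⊤ := (isCompact_closedBall _ _).measure_lt_top.ne
  have : IsProbabilityMeasure (ProbabilityTheory.cond volume B) :=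
    ProbabilityTheory.cond_isProbabilityMeasure_of_finite hB0 hBtop
  obtain ⟨x, hx, hsum⟩ := exists_sum_lintegral_prod_le (ProbabilityTheory.cond volume B) volume
    (ProbabilityTheory.ae_cond_mem isClosed_closedBall.measurableSet)
    (D := closedBall 0 (√((2 * m : ℕ) * P) + r))
    (measurable_gaussWeight (2 * m) (N₁ + ε))
    (lintegral_gaussWeight_cond_le hm hP (by positivity)) M L
  refine exists_packing_of_card_bad_le hN hNN (by omega) hL x hx ?_
  set A := (Finset.powersetCard L Finset.univ).filter
      fun S => famSqRadius S x ≤ (2 * m : ℕ) * N₁ with hA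
  have h1 : (A.card : ENNReal) * volume (closedBall (0 : EuclideanSpace ℝ (Fin (2 * m))) r) ≤
      M.choose L * (volume (closedBall (0 : EuclideanSpace ℝ (Fin (2 * m)))
        (√((2 * m : ℕ) * P) + r)) *
          ENNReal.ofReal (Real.exp 1 * m * ((N₁ + ε) / P) ^ m) ^ L) := by
    refine le_trans ?_ hsum
    refine le_trans ?_ (Finset.sum_le_sum_of_subset (Finset.filter_subset
      (fun S => famSqRadius S x ≤ (2 * m : ℕ) * N₁) _))
    rw [← nsmul_eq_mul]
    refine Finset.card_nsmul_le_sum _ _ _ fun S hS => ?_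
    have hS' := Finset.mem_filter.1 hS
    refine volume_closedBall_le_of_famSqRadius_le hN hε S (Finset.card_pos.1 ?_) x hx hS'.2
    have := (Finset.mem_powersetCard.1 hS'.1).2
    omega
  rw [Measure.addHaar_closedBall _ _ hr0.le, Measure.addHaar_closedBall _ _ (by positivity),
    finrank_euclideanSpace_fin, mul_right_comm, ← mul_assoc, ← mul_assoc, ← mul_assoc,
    ENNReal.mul_le_mul_iff_left (measure_ball_pos _ _ one_pos).ne' measure_ball_lt_top.ne,
    ← ENNReal.ofReal_natCast, ← ENNReal.ofReal_natCast, ← ENNReal.ofReal_pow (by positivity),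
    ← ENNReal.ofReal_mul (by positivity), ← ENNReal.ofReal_mul (by positivity),
    ← ENNReal.ofReal_mul (by positivity), ENNReal.ofReal_le_ofReal_iff (by positivity)] at h1
  have hq : (√P + √ε) / √ε = (√((2 * m : ℕ) * P) + r) / r := by
    rw [hr, Real.sqrt_mul (by positivity), Real.sqrt_mul (by positivity), ← mul_add,
      mul_div_mul_left _ _ (Real.sqrt_pos.2 (by positivity)).ne']
  have h2 : (A.card : ℝ) ≤ (M.choose L : ℝ) * ((((√P + √ε) / √ε) ^ 2) ^ m *
      (Real.exp 1 * m * ((N₁ + ε) / P) ^ m) ^ L) := by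
    rw [hq, ← pow_mul, div_pow, div_mul_eq_mul_div, mul_div_assoc', le_div_iff₀ (by positivity)]
    linarith
  have h3 : (M.choose L : ℝ) ≤ (M : ℝ) ^ L := by exact_mod_cast Nat.choose_le_pow M L
  have h4 : (2 * A.card : ℝ) ≤ M := by
    refine le_trans ?_ hM
    refine mul_le_mul_of_nonneg_left (h2.trans ?_) zero_le_two
    gcongr
  exact_mod_cast h4

/-! ### From cardinalities to rates, and the two capacity bounds -/

theorem _root_.Set.encard_le_ofReal_of_forall_card_le {α : Type*} {C : Set α} {X : ℝ}
    (h : ∀ F : Finset α, (F : Set α) ⊆ C → (F.card : ℝ) ≤ X) :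
    (C.encard : ENNReal) ≤ ENNReal.ofReal X := by
  rcases C.finite_or_infinite with hC | hC
  · have := h hC.toFinset (by simp)
    rw [hC.encard_eq_coe_toFinset_card, ENat.toENNReal_coe, ← ENNReal.ofReal_natCast]
    exact ENNReal.ofReal_le_ofReal this
  · obtain ⟨k, hk⟩ := exists_nat_gt X
    obtain ⟨F, hF, hcard⟩ := hC.exists_subset_card_eq k
    have := h F hF
    rw [hcard] at this
    linarith

theorem rate_le_of_forall_card_le {C : Set (EuclideanSpace ℝ (Fin n))} (hn : n ≠ 0) {c : ℝ}
    (h : ∀ F : Finset (EuclideanSpace ℝ (Fin n)), (F : Set (EuclideanSpace ℝ (Fin n))) ⊆ C →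
      (F.card : ℝ) ≤ Real.exp (n * c)) : rate C ≤ c := by
  have hn' : (0 : EReal) < n := by exact_mod_cast Nat.pos_of_ne_zero hn
  rw [rate, EReal.div_le_iff_le_mul hn' (EReal.natCast_ne_top n)]
  refine (ENNReal.log_monotone (Set.encard_le_ofReal_of_forall_card_le h)).trans ?_
  rw [ENNReal.log_ofReal_of_pos (Real.exp_pos _), Real.log_exp]
  exact le_of_eq (by push_cast; rfl)

theorem le_rate_of_le_card (C : Finset (EuclideanSpace ℝ (Fin n))) (hn : n ≠ 0) {c : ℝ}
    (h : Real.exp (n * c) ≤ C.card) : (c : EReal) ≤ rate (C : Set (EuclideanSpace ℝ (Fin n))) := by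
  have hn' : (0 : EReal) < n := by exact_mod_cast Nat.pos_of_ne_zero hn
  rw [rate, EReal.le_div_iff_mul_le hn' (EReal.natCast_ne_top n)]
  refine le_trans ?_ (ENNReal.log_monotone (a := ENNReal.ofReal (Real.exp (n * c))) ?_)
  · rw [ENNReal.log_ofReal_of_pos (Real.exp_pos _), Real.log_exp]
    exact le_of_eq (by push_cast; rw [mul_comm])
  · rw [Set.encard_coe_eq_coe_finsetCard, ENat.toENNReal_coe, ← ENNReal.ofReal_natCast]
    exact ENNReal.ofReal_le_ofReal h

theorem avgRadiusCapacity_le {P N : ℝ} (hN : 0 < N) (hNP : N ≤ P) (L : ℕ) {c : ℝ}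
    (hc : 1 / 2 * Real.log (P / N) < c) : avgRadiusCapacity P N L ≤ c := by
  have hP : 0 < P := hN.trans_le hNP
  have h1 : Real.exp (-(2 * c)) < N / P := by
    rw [← Real.lt_log_iff_exp_lt (by positivity), ← inv_div, Real.log_inv]
    linarith
  -- `t < N / P` leaves room for `2 * δ`, while `1 / t < exp (2 * c)` keeps the volume ratio below
  -- the target.
  obtain ⟨t, ht, htN⟩ := exists_between h1
  have ht0 : 0 < t := (Real.exp_pos _).trans ht
  have ht1 : t < 1 := htN.trans_le ((div_le_one hP).2 hNP)
  have ht1' : 0 < 1 - t := sub_pos.2 ht1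
  obtain ⟨δ, hδ0, hδ1, hδN, hδ⟩ : ∃ δ : ℝ, 0 < δ ∧ δ ≤ 1 ∧ P * (t + 2 * δ) ≤ N ∧
      (1 - t + 2 * δ) / (t * (1 - t)) < Real.exp (2 * c) := by
    have e1 : ∀ᶠ δ : ℝ in 𝓝 0, P * (t + 2 * δ) < N := by
      refine (ContinuousAt.tendsto (by fun_prop)).eventually_lt_const ?_
      rw [lt_div_iff₀ hP] at htN
      linarith
    have e2 : ∀ᶠ δ : ℝ in 𝓝 0, (1 - t + 2 * δ) / (t * (1 - t)) < Real.exp (2 * c) := by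
      refine (ContinuousAt.tendsto (by fun_prop)).eventually_lt_const ?_
      rw [Real.exp_neg] at ht
      rw [mul_zero, add_zero, div_mul_cancel_right₀ ht1'.ne']
      exact inv_lt_of_inv_lt₀ (Real.exp_pos _) ht
    have e3 : ∀ᶠ δ : ℝ in 𝓝 0, δ < 1 := eventually_lt_nhds one_pos
    obtain ⟨δ, ⟨⟨h1, h2⟩, h3⟩, h4⟩ :=
      ((((e1.and e2).and e3).filter_mono nhdsWithin_le_nhds).and
        (self_mem_nhdsWithin : Set.Ioi (0 : ℝ) ∈ 𝓝[>] 0)).exists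
    exact ⟨δ, h4, h3.le, h1.le, h2⟩
  set A := √((1 - t + 2 * δ) / (t * (1 - t))) with hA
  have hAc : A / Real.exp c < 1 := by
    rw [div_lt_one (Real.exp_pos _), hA, Real.sqrt_lt' (Real.exp_pos _), ← Real.exp_nat_mul]
    exact_mod_cast hδ
  have hlim : Tendsto (fun n : ℕ => (L / δ : ℝ) * (A / Real.exp c) ^ n) atTop (𝓝 0) := by
    simpa using (tendsto_pow_atTop_nhds_zero_of_lt_one (by positivity) hAc).const_mul (L / δ : ℝ)
  refine limsup_le_of_le (by isBoundedDefault) ?_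
  filter_upwards [hlim.eventually_lt_const one_pos, eventually_ne_atTop 0] with n hn hn0
  refine iSup₂_le fun C hC => rate_le_of_forall_card_le hn0 fun F hF => ?_
  refine (hC.card_le hN.le hn0 hP hδ0 hδ1 ht0 ht1 hδN hF).trans ?_
  rw [div_pow, mul_div_assoc', div_lt_one (by positivity)] at hn
  rw [Real.exp_nat_mul]
  exact hn.le

theorem isAvgRadiusPacking_singleton_zero (P N : ℝ) {L : ℕ} (hL : 2 ≤ L) :
    IsAvgRadiusPacking P N L (({0} : Finset (EuclideanSpace ℝ (Fin n))) :
      Set (EuclideanSpace ℝ (Fin n))) := by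
  refine ⟨by simp; positivity, (EReal.coe_lt_top _).trans_le ?_⟩
  refine le_iInf fun s => le_iInf fun hs => le_iInf fun hcard => ?_
  have := Finset.card_le_card (Finset.coe_subset.1 hs)
  rw [Finset.card_singleton] at this
  omega

theorem zero_le_avgRadiusCapacity (P N : ℝ) {L : ℕ} (hL : 2 ≤ L) :
    0 ≤ avgRadiusCapacity P N L := by
  refine le_limsup_of_frequently_le (Eventually.frequently ?_) (by isBoundedDefault)
  filter_upwards [eventually_ne_atTop 0] with n hn
  rw [← EReal.coe_zero]
  exact le_iSup₂_of_le _ (isAvgRadiusPacking_singleton_zero P N hL)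
    (le_rate_of_le_card (c := 0) {0} hn (by simp))

theorem eventually_le_avgRadiusCapacity {P N : ℝ} (hN : 0 < N) (hP : 0 < P) {β : ℝ} (hβ : 0 ≤ β)
    (h : β < 1 / 2 * Real.log (P / N)) :
    ∀ᶠ L : ℕ in atTop, (β : EReal) ≤ avgRadiusCapacity P N L := by
  obtain ⟨γ, hβγ, hγ⟩ := exists_between h
  have h1 : N < P * Real.exp (-(2 * γ)) := by
    have : N / P < Real.exp (-(2 * γ)) := by
      rw [← Real.log_lt_iff_lt_exp (by positivity), ← inv_div, Real.log_inv]
      linarith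
    rwa [div_lt_iff₀' hP] at this
  -- Here `N < N₁ < s < P * exp (-(2 * γ))`, and `s - N₁` serves as `ε`; the upper bound on `s` is
  -- exactly `q < 1`.
  obtain ⟨s, hs, hsP⟩ := exists_between h1
  obtain ⟨N₁, hN₁, hN₁s⟩ := exists_between hs
  set K := ((√P + √(s - N₁)) / √(s - N₁)) ^ 2 with hK
  have hK0 : 0 ≤ K := by positivity
  have hs0 : 0 < s := hN.trans hs
  set q := Real.exp (2 * γ) * (s / P) with hq
  have hq0 : 0 < q := by positivity
  have hq1 : q < 1 := by
    rw [Real.exp_neg, ← div_eq_mul_inv, lt_div_iff₀ (Real.exp_pos _)] at hsP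
    rw [hq, mul_div_assoc', div_lt_one hP]
    linarith
  have hlimL : Tendsto (fun L : ℕ => K * q ^ L) atTop (𝓝 0) := by
    simpa using (tendsto_pow_atTop_nhds_zero_of_lt_one hq0.le hq1).const_mul K
  filter_upwards [hlimL.eventually_lt_const one_pos, eventually_ge_atTop 1] with L hL hL1
  have hlim1 : Tendsto (fun m : ℕ => 2 * Real.exp 1 ^ L * ((m : ℝ) ^ L * (K * q ^ L) ^ m))
      atTop (𝓝 0) := by
    simpa using (tendsto_pow_const_mul_const_pow_of_lt_one L (by positivity) hL).const_mul
      (2 * Real.exp 1 ^ L)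
  have hlim2 : Tendsto (fun m : ℕ => (m : ℝ) * (2 * (γ - β))) atTop atTop :=
    tendsto_natCast_atTop_atTop.atTop_mul_const (by linarith)
  refine le_limsup_of_frequently_le ?_ (by isBoundedDefault)
  refine Tendsto.frequently (tendsto_id.const_mul_atTop' two_pos) (Eventually.frequently ?_)
  filter_upwards [hlim1.eventually_lt_const one_pos, eventually_ge_atTop 1,
    hlim2.eventually_ge_atTop (Real.log (4 * L))] with m hm hm1 hm2
  set X := Real.exp (2 * γ) ^ m with hX
  have hX1 : 1 ≤ X := one_le_pow₀ (Real.one_le_exp (by linarith))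
  set M := ⌊X⌋₊ with hM
  have hMX : (M : ℝ) ≤ X := Nat.floor_le (by linarith)
  have hM1 : (1 : ℝ) ≤ M := by exact_mod_cast Nat.one_le_floor_iff X |>.2 hX1
  have hXM : X < M + 1 := Nat.lt_floor_add_one X
  obtain ⟨C, hC, hCM⟩ := exists_packing (P := P) (N := N) (N₁ := N₁) (ε := s - N₁) hP
    (hN.trans hN₁).le hN₁ (by linarith) (m := m) (L := L) (M := M) hm1 hL1 (by
      rw [add_sub_cancel, ← hK]
      -- The spare factor `M` gives the right side of the expurgation condition and avoids the
      -- exponent `L - 1`.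
      have e : (M : ℝ) ^ L ≤ M * X ^ L := by
        calc (M : ℝ) ^ L ≤ X ^ L := by gcongr
          _ ≤ _ := le_mul_of_one_le_left (by positivity) hM1
      calc 2 * ((M : ℝ) ^ L * (K ^ m * (Real.exp 1 * m * (s / P) ^ m) ^ L))
          ≤ 2 * ((M * X ^ L) * (K ^ m * (Real.exp 1 * m * (s / P) ^ m) ^ L)) := by gcongr
        _ = M * (2 * Real.exp 1 ^ L * ((m : ℝ) ^ L * (K * q ^ L) ^ m)) := by
            rw [hX, hq]
            simp only [mul_pow, ← pow_mul, mul_comm m L]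
            ring
        _ ≤ M := mul_le_of_le_one_right (by positivity) hm.le)
  refine le_iSup₂_of_le _ hC (le_rate_of_le_card C (by simp; omega) ?_)
  have hL0 : (0 : ℝ) < L := by exact_mod_cast hL1
  -- Expurgation loses a factor `2 * L` and the floor another 2; the gap between `β` and `γ` absorbs
  -- both for large `m`.
  have e1 : (4 * L : ℝ) * Real.exp ((2 * m : ℕ) * β) ≤ X := by
    rw [hX, ← Real.exp_nat_mul, ← Real.exp_log (show (0 : ℝ) < 4 * L by positivity),
      ← Real.exp_add, Real.exp_le_exp]
    push_cast
    linarith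
  have e2 : (M : ℝ) ≤ 2 * (L * C.card) := by exact_mod_cast hCM
  have e3 : (4 * L : ℝ) * Real.exp ((2 * m : ℕ) * β) ≤ 4 * L * C.card := by linarith
  exact le_of_mul_le_mul_left e3 (by positivity)

end MultiplePacking

end

theorem mainTheorem5 (P N : ℝ) (hN : 0 < N) (hNP : N ≤ P) :
    Tendsto (fun L : ℕ => MultiplePacking.avgRadiusCapacity P N L) atTop
      (𝓝 (((1 / 2 * Real.log (P / N) : ℝ)) : EReal)) := by
  refine tendsto_order.2 ⟨fun a ha => ?_, fun a ha => ?_⟩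
  · obtain ⟨β, haβ, hβ⟩ := EReal.lt_iff_exists_real_btwn.1 ha
    -- Random coding needs `β ≥ 0`; below that a one-point code suffices. For `P = N` only this
    -- first case occurs.
    rcases lt_or_ge β 0 with h0 | h0
    · filter_upwards [eventually_ge_atTop 2] with L hL
      exact haβ.trans ((EReal.coe_lt_coe_iff.2 h0).trans_le
        (MultiplePacking.zero_le_avgRadiusCapacity P N hL))
    · filter_upwards [MultiplePacking.eventually_le_avgRadiusCapacity hN (hN.trans_le hNP) h0
        (EReal.coe_lt_coe_iff.1 hβ)] with L hL
      exact haβ.trans_le hL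
  · obtain ⟨c, hc, hca⟩ := EReal.lt_iff_exists_real_btwn.1 ha
    exact Eventually.of_forall fun L =>
      (MultiplePacking.avgRadiusCapacity_le hN hNP L (EReal.coe_lt_coe_iff.1 hc)).trans_lt hca
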